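/- Equip $\mathbb{Z}^4$ with the quadratic form $Q(x_1,x_2,x_3,x_4)=x_1x_2+x_3x_4$ and with the integral symplectic form $\theta$ given by $\theta(e_1,e_2)=-\theta(e_2,e_1)=\theta(e_3,e_4)=-\theta(e_4,e_3)=1$ and $\theta(e_i,e_j)=0$ for $\{i,j\}\notin\{\{1,2\},\{3,4\}\}$. A plane is an oriented direct summand $L\subset\mathbb{Z}^4$ of rank two; $[Q|_L]$ denotes the $\mathrm{SL}_2(\mathbb{Z})$-equivalence class of the integral binary quadratic form $Q(xv_1+yv_2)$ for an oriented basis $(v_1,v_2)$ of $L$. The plane $L$ is symplectic if it has an oriented basis $(v_1,v_2)$ with $\theta(v_1,v_2)=1$; its symplectic complement is then $L^{\perp_\theta}=\{x\in\mathbb{Z}^4:\theta(x,y)=0\text{ for all }y\in L\}$, with the orientation that makes it symplectic. The discriminant of $ax^2+bxy+cy^2$ is $b^2-4ac$, and $\overline{[q(x,y)]}=[q(-x,y)]$ is the orientation reversal of a class $[q]$. Let $D\equiv 1\pmod 4$ be an integer. The following are equivalent. (i) There is a symplectic plane $L\subset\mathbb{Z}^4$ such that $Q|_L$ has discriminant $D$,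 $[Q|_L]\neq[Q|_{L^{\perp_\theta}}]$ and $[Q|_L]\neq\overline{[Q|_{L^{\perp_\theta}}]}$. (ii) There exist $a,c\in\mathbb{Z}$ with $1-4ac=D$ and $[ax^2+xy+cy^2]^2\neq 1$, where the square is taken with respect to Gauss composition in the oriented class group of $\mathrm{SL}_2(\mathbb{Z})$-classes of primitive integral binary quadratic forms of discriminant $D$ (definite forms of either sign being allowed when $D<0$), whose neutral element is $1=[x^2+xy+\tfrac{1-D}{4}y^2]$. -/

import Mathlib

/-- The integral binary quadratic form `a x² + b x y + c y²`. -/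
@[ext]
structure IBQF where
  a : ℤ
  b : ℤ
  c : ℤ

namespace IBQF

/-- The value `q(x, y)`. -/
def eval (q : IBQF) (x y : ℤ) : ℤ := q.a * x ^ 2 + q.b * x * y + q.c * y ^ 2

/-- The discriminant `b² - 4ac`. -/
def disc (q : IBQF) : ℤ := q.b ^ 2 - 4 * q.a * q.c

/-- The content: the greatest common divisor of the coefficients. -/
def content (q : IBQF) : ℕ := Int.gcd q.a (Int.gcd q.b q.c)

/-- The orientation reversal `q(-x, y)`. -/
def reverse (q : IBQF) : IBQF := ⟨q.a, -q.b, q.c⟩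

/-- The substitution `(x, y) ↦ (p x + r y, s x + t y)` in `q`, written out in coefficients. -/
def subst (q : IBQF) (p r s t : ℤ) : IBQF :=
  ⟨q.a * p ^ 2 + q.b * p * s + q.c * s ^ 2,
    2 * q.a * p * r + q.b * (p * t + r * s) + 2 * q.c * s * t,
    q.a * r ^ 2 + q.b * r * t + q.c * t ^ 2⟩

theorem eval_subst (q : IBQF) (p r s t x y : ℤ) :
    (q.subst p r s t).eval x y = q.eval (p * x + r * y) (s * x + t * y) := by
  simp only [eval, subst]; ring

theorem eval_reverse (q : IBQF) (x y : ℤ) : q.reverse.eval x y = q.eval (-x) y := by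
  simp only [eval, reverse]; ring

/-- Proper equivalence: `q'` is obtained from `q` by a substitution in `SL₂(ℤ)`. -/
def Equivalent (q q' : IBQF) : Prop :=
  ∃ g : Matrix.SpecialLinearGroup (Fin 2) ℤ, q' = q.subst (g 0 0) (g 0 1) (g 1 0) (g 1 1)

theorem equivalent_iff (q q' : IBQF) :
    q.Equivalent q' ↔ ∃ p r s t : ℤ, p * t - r * s = 1 ∧ q' = q.subst p r s t := by
  constructor
  · rintro ⟨g, h⟩
    have hg := g.det_coe
    rw [Matrix.det_fin_two] at hg
    exact ⟨_, _, _, _, hg, h⟩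
  · rintro ⟨p, r, s, t, h1, h2⟩
    exact ⟨⟨!![p, r; s, t], by rw [Matrix.det_fin_two_of, h1]⟩, by simpa using h2⟩

/-- Proper equivalence as a setoid. -/
instance setoid : Setoid IBQF where
  r := Equivalent
  iseqv := by
    refine ⟨fun q => ?_, fun {q q'} h => ?_, fun {q q' q''} h h' => ?_⟩
    · rw [equivalent_iff]
      exact ⟨1, 0, 0, 1, by norm_num, by ext <;> simp [subst]⟩
    · rw [equivalent_iff] at h ⊢
      obtain ⟨p, r, s, t, h, rfl⟩ := h
      refine ⟨t, -r, -s, p, by linarith, ?_⟩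
      ext <;> simp only [subst]
      · linear_combination (-q.a * (p * t - r * s + 1)) * h
      · linear_combination (-q.b * (p * t - r * s + 1)) * h
      · linear_combination (-q.c * (p * t - r * s + 1)) * h
    · rw [equivalent_iff] at h h' ⊢
      obtain ⟨p, r, s, t, h, rfl⟩ := h
      obtain ⟨p', r', s', t', h', rfl⟩ := h'
      refine ⟨p * p' + r * s', p * r' + r * t', s * p' + t * s', s * r' + t * t', ?_, ?_⟩
      · linear_combination (p' * t' - r' * s') * h + h'
      · ext <;> simp only [subst] <;> ring

theorem equiv_def {q q' : IBQF} :
    q ≈ q' ↔ ∃ p r s t : ℤ, p * t - r * s = 1 ∧ q' = q.subst p r s t :=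
  equivalent_iff q q'

theorem disc_eq_of_equiv {q q' : IBQF} (h : q ≈ q') : q.disc = q'.disc := by
  obtain ⟨p, r, s, t, hg, rfl⟩ := equiv_def.1 h
  simp only [disc, subst]
  linear_combination (-(q.b ^ 2 - 4 * q.a * q.c) * (p * t - r * s + 1)) * hg

theorem reverse_equiv {q q' : IBQF} (h : q ≈ q') : q.reverse ≈ q'.reverse := by
  obtain ⟨p, r, s, t, h, rfl⟩ := equiv_def.1 h
  refine equiv_def.2 ⟨p, -r, -s, t, by linarith, ?_⟩
  ext <;> simp only [subst, reverse] <;> ring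

theorem dvd_content_iff (q : IBQF) (d : ℕ) :
    d ∣ q.content ↔ (d : ℤ) ∣ q.a ∧ (d : ℤ) ∣ q.b ∧ (d : ℤ) ∣ q.c := by
  rw [content, Int.dvd_gcd_iff, Int.natCast_dvd_natCast, Int.dvd_gcd_iff]

theorem content_dvd_of_equiv {q q' : IBQF} (h : q ≈ q') : q.content ∣ q'.content := by
  obtain ⟨p, r, s, t, -, rfl⟩ := equiv_def.1 h
  obtain ⟨⟨x, hx⟩, ⟨y, hy⟩, ⟨z, hz⟩⟩ := (q.dvd_content_iff q.content).1 dvd_rfl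
  rw [dvd_content_iff]
  simp only [subst]
  refine ⟨⟨x * p ^ 2 + y * p * s + z * s ^ 2, ?_⟩,
    ⟨2 * x * p * r + y * (p * t + r * s) + 2 * z * s * t, ?_⟩,
    ⟨x * r ^ 2 + y * r * t + z * t ^ 2, ?_⟩⟩
  · linear_combination p ^ 2 * hx + p * s * hy + s ^ 2 * hz
  · linear_combination 2 * p * r * hx + (p * t + r * s) * hy + 2 * s * t * hz
  · linear_combination r ^ 2 * hx + r * t * hy + t ^ 2 * hz

theorem content_eq_of_equiv {q q' : IBQF} (h : q ≈ q') : q.content = q'.content :=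
  Nat.dvd_antisymm (content_dvd_of_equiv h) (content_dvd_of_equiv (Setoid.symm h))

end IBQF

/-- The set of `SL₂(ℤ)`-equivalence classes `[q]` of integral binary quadratic forms. -/
def FormClass : Type := Quotient IBQF.setoid

namespace FormClass

/-- The class `[q]`. -/
def mk (q : IBQF) : FormClass := Quotient.mk IBQF.setoid q

theorem mk_eq_mk {q q' : IBQF} : mk q = mk q' ↔ q ≈ q' := Quotient.eq

/-- The discriminant of a class. -/
def disc : FormClass → ℤ := Quotient.lift IBQF.disc fun _ _ => IBQF.disc_eq_of_equiv

/-- The content of a class. -/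
def content : FormClass → ℕ := Quotient.lift IBQF.content fun _ _ => IBQF.content_eq_of_equiv

/-- The orientation reversal of a class: `[q(x, y)] ↦ [q(-x, y)]`. -/
def reverse : FormClass → FormClass :=
  Quotient.map IBQF.reverse fun _ _ => IBQF.reverse_equiv

/-- Gauss composition in Dirichlet's form: `u` is a composition of `s` and `t` if there are
concordant representatives `a₁x² + bxy + a₂c y²` of `s` and `a₂x² + bxy + a₁c y²` of `t` such that
`a₁a₂x² + bxy + c y²` represents `u`. -/
def IsComposition (s t u : FormClass) : Prop :=
  ∃ a₁ a₂ b c : ℤ, s = mk ⟨a₁, b, a₂ * c⟩ ∧ t = mk ⟨a₂, b, a₁ * c⟩ ∧ u = mk ⟨a₁ * a₂, b, c⟩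

end FormClass

/-! ### Existence and uniqueness of the composition of primitive classes -/

namespace IBQF

theorem isUnit_of_content {q : IBQF} (hq : q.content = 1) {d : ℕ} (h1 : (d : ℤ) ∣ q.a)
    (h2 : (d : ℤ) ∣ q.b) (h3 : (d : ℤ) ∣ q.c) : d = 1 := by
  have := (q.dvd_content_iff d).2 ⟨h1, h2, h3⟩
  rw [hq] at this
  exact Nat.dvd_one.1 this

theorem exists_bezout {q : IBQF} (hq : q.content = 1) :
    ∃ u v w : ℤ, u * q.a + v * q.b + w * q.c = 1 := by
  have h1 := Int.gcd_eq_gcd_ab q.a (Int.gcd q.b q.c)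
  have h2 := Int.gcd_eq_gcd_ab q.b q.c
  rw [content] at hq
  rw [hq] at h1
  generalize Int.gcdA q.a (Int.gcd q.b q.c) = e at *
  generalize Int.gcdB q.a (Int.gcd q.b q.c) = f at *
  rw [h2] at h1
  exact ⟨e, Int.gcdA q.b q.c * f, Int.gcdB q.b q.c * f, by push_cast at h1; linarith⟩

/-- A `2 × 2 × 2` cube of integers `(xᵢⱼ, yᵢⱼ)` whose three associated forms are `q₁`, `q₂` and,
up to sign conventions, `q₃`. -/
def IsCube (X Y : Fin 4 → ℤ) (q₁ q₂ q₃ : IBQF) : Prop :=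
  q₁ = ⟨X 0 * Y 1 - X 1 * Y 0, X 0 * Y 3 - X 3 * Y 0 - (X 1 * Y 2 - X 2 * Y 1),
    X 2 * Y 3 - X 3 * Y 2⟩ ∧
  q₂ = ⟨X 0 * Y 2 - X 2 * Y 0, X 0 * Y 3 - X 3 * Y 0 + (X 1 * Y 2 - X 2 * Y 1),
    X 1 * Y 3 - X 3 * Y 1⟩ ∧
  q₃ = ⟨Y 1 * Y 2 - Y 0 * Y 3, Y 0 * X 3 + X 0 * Y 3 - Y 1 * X 2 - X 1 * Y 2,
    X 1 * X 2 - X 0 * X 3⟩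

theorem isCube_concordant (a₁ a₂ b c : ℤ) :
    IsCube ![1, 0, 0, -c] ![0, a₁, a₂, b] ⟨a₁, b, a₂ * c⟩ ⟨a₂, b, a₁ * c⟩ ⟨a₁ * a₂, b, c⟩ := by
  refine ⟨?_, ?_, ?_⟩ <;> ext <;> simp [mul_comm]

theorem IsCube.subst_left {X Y : Fin 4 → ℤ} {q₁ q₂ q₃ : IBQF} (h : IsCube X Y q₁ q₂ q₃)
    {p r s t : ℤ} (hg : p * t - r * s = 1) :
    IsCube ![p * X 0 + s * X 2, p * X 1 + s * X 3, r * X 0 + t * X 2, r * X 1 + t * X 3]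
      ![p * Y 0 + s * Y 2, p * Y 1 + s * Y 3, r * Y 0 + t * Y 2, r * Y 1 + t * Y 3]
      (q₁.subst p r s t) q₂ q₃ := by
  obtain ⟨rfl, rfl, rfl⟩ := h
  refine ⟨?_, ?_, ?_⟩ <;> ext <;> simp [subst]
  · ring
  · ring
  · ring
  · linear_combination (-(X 0 * Y 2 - X 2 * Y 0)) * hg
  · linear_combination (-(X 0 * Y 3 - X 3 * Y 0 + (X 1 * Y 2 - X 2 * Y 1))) * hg
  · linear_combination (-(X 1 * Y 3 - X 3 * Y 1)) * hg
  · linear_combination (-(Y 1 * Y 2 - Y 0 * Y 3)) * hg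
  · linear_combination (-(Y 0 * X 3 + X 0 * Y 3 - Y 1 * X 2 - X 1 * Y 2)) * hg
  · linear_combination (-(X 1 * X 2 - X 0 * X 3)) * hg

theorem IsCube.swap {X Y : Fin 4 → ℤ} {q₁ q₂ q₃ : IBQF} (h : IsCube X Y q₁ q₂ q₃) :
    IsCube ![X 0, X 2, X 1, X 3] ![Y 0, Y 2, Y 1, Y 3] q₂ q₁ q₃ := by
  obtain ⟨rfl, rfl, rfl⟩ := h
  refine ⟨?_, ?_, ?_⟩ <;> ext <;> simp <;> ring

theorem IsCube.exists_left {X Y : Fin 4 → ℤ} {q₁ q₂ q₃ q : IBQF} (h : IsCube X Y q₁ q₂ q₃)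
    (hq : q₁ ≈ q) : ∃ X' Y' : Fin 4 → ℤ, IsCube X' Y' q q₂ q₃ := by
  obtain ⟨p, r, s, t, hg, rfl⟩ := equiv_def.1 hq
  exact ⟨_, _, h.subst_left hg⟩

theorem IsCube.unique {X Y X' Y' : Fin 4 → ℤ} {q₁ q₂ q₃ q₃' : IBQF} (hq : q₁.content = 1)
    (h : IsCube X Y q₁ q₂ q₃) (h' : IsCube X' Y' q₁ q₂ q₃') : q₃ ≈ q₃' := by
  obtain ⟨u, v, w, hb⟩ := exists_bezout hq
  obtain ⟨rfl, rfl, rfl⟩ := h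
  obtain ⟨h1, h2, rfl⟩ := h'
  rw [IBQF.mk.injEq] at h1 h2
  obtain ⟨m01, e1, m23⟩ := h1
  obtain ⟨m02, e2, m13⟩ := h2
  have m03 : X 0 * Y 3 - X 3 * Y 0 = X' 0 * Y' 3 - X' 3 * Y' 0 := by linarith
  have m12 : X 1 * Y 2 - X 2 * Y 1 = X' 1 * Y' 2 - X' 2 * Y' 1 := by linarith
  clear e1 e2
  have hm : ∀ i j, X i * Y j - X j * Y i = X' i * Y' j - X' j * Y' i := by
    intro i j
    fin_cases i <;> fin_cases j <;> simp only [Fin.zero_eta, Fin.mk_one, Fin.reduceFinMk] <;>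
      linarith
  simp only at hb
  have key : ∀ Z : Fin 4 → ℤ, (∀ i j k, Z k * (X' i * Y' j - X' j * Y' i) =
      Z i * (X' k * Y' j - X' j * Y' k) + Z j * (X' i * Y' k - X' k * Y' i)) →
      ∃ α β : ℤ, ∀ k, Z k = α * X k + β * Y k := by
    intro Z hZ
    refine ⟨u * (Z 0 * Y 1 - Z 1 * Y 0)
      + v * (Z 0 * Y 3 - Z 3 * Y 0 - (Z 1 * Y 2 - Z 2 * Y 1)) + w * (Z 2 * Y 3 - Z 3 * Y 2),
      u * (X 0 * Z 1 - X 1 * Z 0)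
      + v * (X 0 * Z 3 - X 3 * Z 0 - (X 1 * Z 2 - X 2 * Z 1)) + w * (X 2 * Z 3 - X 3 * Z 2),
      fun k => ?_⟩
    have hZ' : ∀ i j, Z k * (X i * Y j - X j * Y i) =
      Z i * (X k * Y j - X j * Y k) + Z j * (X i * Y k - X k * Y i) := by
      intro i j
      rw [hm, hm, hm]
      exact hZ i j k
    linear_combination (-Z k) * hb + u * hZ' 0 1 + v * (hZ' 0 3 - hZ' 1 2) + w * hZ' 2 3
  obtain ⟨α, β, hX⟩ := key X' (fun i j k => by ring)
  obtain ⟨γ, δ, hY⟩ := key Y' (fun i j k => by ring)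
  have hdet : α * δ - β * γ = 1 := by
    have hd : ∀ i j, (α * δ - β * γ) * (X i * Y j - X j * Y i) = X i * Y j - X j * Y i := by
      intro i j
      have := hm i j
      rw [hX i, hX j, hY i, hY j] at this
      linear_combination -this
    linear_combination (1 - (α * δ - β * γ)) * hb + u * hd 0 1 + v * (hd 0 3 - hd 1 2) + w * hd 2 3
  refine equiv_def.2 ⟨δ, -β, -γ, α, by linarith, ?_⟩
  ext <;> simp only [subst, hX, hY] <;> ring

/-- A properly represented integer is the leading coefficient of an equivalent form. -/
theorem exists_equiv_a_eq (q : IBQF) {x y : ℤ} (h : IsCoprime x y) :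
    ∃ q' : IBQF, q ≈ q' ∧ q'.a = q.eval x y := by
  obtain ⟨u, v, h⟩ := h
  refine ⟨q.subst x (-v) y u, equiv_def.2 ⟨x, -v, y, u, by linarith, rfl⟩, ?_⟩
  simp only [subst, eval]

theorem exists_equiv_not_dvd (q : IBQF) (hq : q.content = 1) (S : Finset ℕ)
    (hS : ∀ p ∈ S, p.Prime) : ∃ q' : IBQF, q ≈ q' ∧ ∀ p ∈ S, ¬ (p : ℤ) ∣ q'.a := by
  induction S using Finset.induction_on with
  | empty => exact ⟨q, Setoid.refl q, by simp⟩
  | insert p S hpS ih =>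
    obtain ⟨q', hqq', hS'⟩ := ih fun r hr => hS r (Finset.mem_insert_of_mem hr)
    have hp : p.Prime := hS p (Finset.mem_insert_self _ _)
    have hq' : q'.content = 1 := by rw [← content_eq_of_equiv hqq', hq]
    by_cases ha : (p : ℤ) ∣ q'.a
    swap
    · refine ⟨q', hqq', fun r hr => ?_⟩
      rcases Finset.mem_insert.1 hr with rfl | hr
      exacts [ha, hS' r hr]
    have hpi : Prime (p : ℤ) := Nat.prime_iff_prime_int.1 hp
    set P : ℤ := ((∏ r ∈ S, r : ℕ) : ℤ) with hP
    have hcop : Nat.Coprime p (∏ r ∈ S, r) := by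
      refine Nat.Coprime.prod_right fun r hr => ?_
      refine (Nat.coprime_primes hp (hS r (Finset.mem_insert_of_mem hr))).2 ?_
      rintro rfl
      exact hpS hr
    have hcopi : IsCoprime (p : ℤ) P := Nat.isCoprime_iff_coprime.2 hcop
    have hpP : ¬ (p : ℤ) ∣ P := fun h => hpi.not_isUnit (hcopi.isUnit_of_dvd' dvd_rfl h)
    have hdP : ∀ r ∈ S, (r : ℤ) ∣ P := fun r hr =>
      Int.natCast_dvd_natCast.2 (Finset.dvd_prod_of_mem _ hr)
    obtain ⟨x, hx, hxr, hxp⟩ : ∃ x : ℤ, IsCoprime x P ∧ (∀ r ∈ S, ¬ (r : ℤ) ∣ x) ∧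
        ¬ (p : ℤ) ∣ q'.eval x P := by
      by_cases hc : (p : ℤ) ∣ q'.c
      · have hb : ¬ (p : ℤ) ∣ q'.b := fun hb => hp.one_lt.ne' (isUnit_of_content hq' ha hb hc)
        refine ⟨1, isCoprime_one_left, fun r hr h => ?_, fun h => ?_⟩
        · exact (Nat.prime_iff_prime_int.1
            (hS r (Finset.mem_insert_of_mem hr))).not_isUnit (isUnit_of_dvd_one h)
        · have h2 : (p : ℤ) ∣ q'.b * P := by
            have : q'.b * P = q'.eval 1 P - q'.a - q'.c * P ^ 2 := by simp only [eval]; ring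
            rw [this]
            exact dvd_sub (dvd_sub h ha) (hc.mul_right _)
          rcases hpi.dvd_or_dvd h2 with h2 | h2
          exacts [hb h2, hpP h2]
      · refine ⟨p, hcopi, fun r hr h => ?_, fun h => ?_⟩
        · have hr' := hS r (Finset.mem_insert_of_mem hr)
          have := (Nat.prime_dvd_prime_iff_eq hr' hp).1 (Int.natCast_dvd_natCast.1 h)
          exact hpS (this ▸ hr)
        · have h2 : (p : ℤ) ∣ q'.c * P ^ 2 := by
            have : q'.c * P ^ 2 = q'.eval p P - p * (q'.a * p + q'.b * P) := by
              simp only [eval]; ring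
            rw [this]
            exact dvd_sub h (dvd_mul_right _ _)
          rcases hpi.dvd_or_dvd h2 with h2 | h2
          exacts [hc h2, hpP (hpi.dvd_of_dvd_pow h2)]
    obtain ⟨q'', hq'', haq⟩ := q'.exists_equiv_a_eq hx
    refine ⟨q'', Setoid.trans hqq' hq'', fun r hr => ?_⟩
    rw [haq]
    rcases Finset.mem_insert.1 hr with rfl | hr
    · exact hxp
    · intro h
      have hri := Nat.prime_iff_prime_int.1 (hS r (Finset.mem_insert_of_mem hr))
      have h2 : (r : ℤ) ∣ q'.a * x ^ 2 := by
        have : q'.a * x ^ 2 = q'.eval x P - P * (q'.b * x + q'.c * P) := by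
          simp only [eval]; ring
        rw [this]
        exact dvd_sub h ((hdP r hr).mul_right _)
      rcases hri.dvd_or_dvd h2 with h2 | h2
      exacts [hS' r hr h2, hxr r hr (hri.dvd_of_dvd_pow h2)]

theorem exists_equiv_isCoprime (q : IBQF) (hq : q.content = 1) {N : ℤ} (hN : N ≠ 0) :
    ∃ q' : IBQF, q ≈ q' ∧ IsCoprime q'.a N := by
  obtain ⟨q', h, hq'⟩ := q.exists_equiv_not_dvd hq N.natAbs.primeFactors
    fun p => Nat.prime_of_mem_primeFactors
  refine ⟨q', h, ?_⟩
  rw [Int.isCoprime_iff_gcd_eq_one]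
  by_contra hg
  obtain ⟨p, hp, hpd⟩ := Nat.exists_prime_and_dvd hg
  rw [Int.dvd_gcd_iff] at hpd
  exact hq' p (Nat.mem_primeFactors.2 ⟨hp, Int.natCast_dvd.1 hpd.2, Int.natAbs_ne_zero.2 hN⟩) hpd.1

theorem exists_concordant (q₁ q₂ : IBQF) (h₁ : q₁.content = 1) (h₂ : q₂.content = 1)
    (hD : q₁.disc = q₂.disc) : ∃ a₁ a₂ b c : ℤ,
      q₁ ≈ ⟨a₁, b, a₂ * c⟩ ∧ q₂ ≈ ⟨a₂, b, a₁ * c⟩ := by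
  obtain ⟨f, hf, hfa⟩ := q₁.exists_equiv_isCoprime h₁ (N := 2) (by norm_num)
  have hf0 : f.a ≠ 0 := by
    intro h
    rw [h, isCoprime_zero_left] at hfa
    exact absurd (Int.isUnit_iff.1 hfa) (by norm_num)
  obtain ⟨g, hg, hga⟩ := q₂.exists_equiv_isCoprime h₂ (N := 2 * f.a) (by simpa using hf0)
  have hg0 : g.a ≠ 0 := by
    intro h
    rw [h, isCoprime_zero_left] at hga
    have := isUnit_of_mul_isUnit_left hga
    exact absurd (Int.isUnit_iff.1 this) (by norm_num)
  have hco : IsCoprime f.a g.a := hga.symm.of_mul_left_right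
  have hdisc : f.disc = g.disc := by
    rw [← disc_eq_of_equiv hf, hD, disc_eq_of_equiv hg]
  simp only [disc] at hdisc
  obtain ⟨m, hm⟩ : ∃ m, g.b - f.b = 2 * m := by
    have h : Even (g.b ^ 2 - f.b ^ 2) := ⟨2 * (g.a * g.c - f.a * f.c), by linarith⟩
    rw [Int.even_sub, Int.even_pow' two_ne_zero, Int.even_pow' two_ne_zero, ← Int.even_sub] at h
    obtain ⟨m, hm⟩ := h
    exact ⟨m, by linarith⟩
  obtain ⟨u, v, huv⟩ := hco
  set f' : IBQF := f.subst 1 (u * m) 0 1 with hf'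
  set g' : IBQF := g.subst 1 (-(v * m)) 0 1 with hg'
  have hff : f ≈ f' := equiv_def.2 ⟨1, u * m, 0, 1, by ring, rfl⟩
  have hgg : g ≈ g' := equiv_def.2 ⟨1, -(v * m), 0, 1, by ring, rfl⟩
  have ha1 : f'.a = f.a := by simp [hf', subst]
  have ha2 : g'.a = g.a := by simp [hg', subst]
  have hb : f'.b = g'.b := by
    simp only [hf', hg', subst]
    linear_combination (2 * m) * huv - hm
  have hd : f'.disc = g'.disc := by
    rw [← disc_eq_of_equiv hff, ← disc_eq_of_equiv hgg]; exact hdisc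
  simp only [disc] at hd
  rw [hb, ha1, ha2] at hd
  have hac : f.a * f'.c = g.a * g'.c := by linarith
  have hdvd : g.a ∣ f'.c := by
    have hco' : IsCoprime g.a f.a := IsCoprime.symm ⟨u, v, huv⟩
    exact hco'.dvd_of_dvd_mul_left ⟨_, hac⟩
  obtain ⟨c, hc⟩ := hdvd
  refine ⟨f.a, g.a, g'.b, c, ?_, ?_⟩
  · have : f' = ⟨f.a, g'.b, g.a * c⟩ := by ext; exacts [ha1, hb, hc]
    exact this ▸ Setoid.trans hf hff
  · have hc' : g'.c = f.a * c := by
      apply mul_left_cancel₀ hg0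
      rw [← hac, hc]; ring
    have : g' = ⟨g.a, g'.b, f.a * c⟩ := by ext; exacts [ha2, rfl, hc']
    exact Setoid.trans hg (Setoid.trans hgg (this ▸ Setoid.refl g'))

theorem content_composition {a₁ a₂ b c : ℤ} (h₁ : (⟨a₁, b, a₂ * c⟩ : IBQF).content = 1)
    (h₂ : (⟨a₂, b, a₁ * c⟩ : IBQF).content = 1) : (⟨a₁ * a₂, b, c⟩ : IBQF).content = 1 := by
  by_contra hg
  obtain ⟨p, hp, hpd⟩ := Nat.exists_prime_and_dvd hg
  obtain ⟨ha, hb, hc⟩ := (dvd_content_iff _ p).1 hpd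
  simp only at ha hb hc
  rcases (Nat.prime_iff_prime_int.1 hp).dvd_or_dvd ha with ha | ha
  · exact hp.one_lt.ne' (isUnit_of_content h₁ ha hb (hc.mul_left _))
  · exact hp.one_lt.ne' (isUnit_of_content h₂ ha hb (hc.mul_left _))

end IBQF

/-- The oriented class group of discriminant `D`, as a set: the `SL₂(ℤ)`-classes of primitive
forms of discriminant `D`. -/
def OrientedClassGroup (D : ℤ) : Type := {s : FormClass // s.disc = D ∧ s.content = 1}

namespace OrientedClassGroup

/-- The class of a primitive form of discriminant `D`. -/
def mk {D : ℤ} (q : IBQF) (hD : q.disc = D) (hq : q.content = 1) : OrientedClassGroup D :=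
  ⟨FormClass.mk q, hD, hq⟩

/-- Any two primitive classes of the same discriminant have exactly one composition. -/
theorem existsUnique_composition {D : ℤ} (s t : OrientedClassGroup D) :
    ∃! u : OrientedClassGroup D, FormClass.IsComposition s.1 t.1 u.1 := by
  obtain ⟨s, hsD, hs⟩ := s
  obtain ⟨t, htD, ht⟩ := t
  induction s using Quotient.inductionOn with | _ q₁ => ?_
  induction t using Quotient.inductionOn with | _ q₂ => ?_
  change q₁.disc = D at hsD
  change q₂.disc = D at htD
  change q₁.content = 1 at hs
  change q₂.content = 1 at ht
  obtain ⟨a₁, a₂, b, c, h₁, h₂⟩ := q₁.exists_concordant q₂ hs ht (hsD.trans htD.symm)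
  refine ⟨mk ⟨a₁ * a₂, b, c⟩ ?_ ?_, ?_, ?_⟩
  · rw [← hsD, IBQF.disc_eq_of_equiv h₁]; simp only [IBQF.disc]; ring
  · refine IBQF.content_composition (a₁ := a₁) (a₂ := a₂) ?_ ?_
    · rw [← IBQF.content_eq_of_equiv h₁, hs]
    · rw [← IBQF.content_eq_of_equiv h₂, ht]
  · exact ⟨a₁, a₂, b, c, Quotient.sound h₁, Quotient.sound h₂, rfl⟩
  · rintro ⟨u, hu⟩ ⟨a₁', a₂', b', c', h₁', h₂', h₃'⟩
    apply Subtype.ext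
    change u = FormClass.mk _
    change u = _ at h₃'
    rw [h₃', FormClass.mk_eq_mk]
    have e₁ : q₁ ≈ _ := Quotient.exact h₁'
    have e₂ : q₂ ≈ _ := Quotient.exact h₂'
    obtain ⟨X, Y, hX⟩ := (IBQF.isCube_concordant a₁ a₂ b c).exists_left (Setoid.symm h₁)
    obtain ⟨X₂, Y₂, hX₂⟩ := hX.swap.exists_left (Setoid.symm h₂)
    obtain ⟨X', Y', hX'⟩ := (IBQF.isCube_concordant a₁' a₂' b' c').exists_left (Setoid.symm e₁)
    obtain ⟨X₂', Y₂', hX₂'⟩ := hX'.swap.exists_left (Setoid.symm e₂)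
    exact IBQF.IsCube.unique ht hX₂' hX₂

/-- Gauss composition on the oriented class group. -/
noncomputable instance {D : ℤ} : Mul (OrientedClassGroup D) :=
  ⟨fun s t => (existsUnique_composition s t).choose⟩

theorem mul_eq_iff {D : ℤ} (s t u : OrientedClassGroup D) :
    s * t = u ↔ FormClass.IsComposition s.1 t.1 u.1 :=
  ⟨fun h => h ▸ (existsUnique_composition s t).choose_spec.1,
    fun h => ((existsUnique_composition s t).choose_spec.2 u h).symm⟩

/-- The neutral class `[x² + xy + (1 - D)/4 y²]` for `D ≡ 1 (mod 4)`. -/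
def principal {D : ℤ} (hD : D ≡ 1 [ZMOD 4]) : OrientedClassGroup D :=
  mk ⟨1, 1, (1 - D) / 4⟩
    (by
      have h : (4 : ℤ) ∣ 1 - D := hD.dvd
      have := Int.mul_ediv_cancel' h
      simp only [IBQF.disc]; linarith)
    (by simp [IBQF.content])

/-- The class `[a x² + xy + c y²]` of discriminant `D = 1 - 4ac`. -/
def special {D : ℤ} (a c : ℤ) (h : 1 - 4 * a * c = D) : OrientedClassGroup D :=
  mk ⟨a, 1, c⟩ (by simp only [IBQF.disc]; linarith) (by simp [IBQF.content])

end OrientedClassGroup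

/-! ### Planes in `ℤ⁴` -/

/-- The quadratic form `x₁x₂ + x₃x₄` on `ℤ⁴`. -/
def ambientForm (x : Fin 4 → ℤ) : ℤ := x 0 * x 1 + x 2 * x 3

/-- The symplectic form on `ℤ⁴` with `θ(e₁, e₂) = θ(e₃, e₄) = 1` and `θ(eᵢ, eⱼ) = 0` for
`{i, j} ≠ {1, 2}, {3, 4}`. -/
def theta (x y : Fin 4 → ℤ) : ℤ := x 0 * y 1 - x 1 * y 0 + (x 2 * y 3 - x 3 * y 2)

theorem theta_add_left (x y z : Fin 4 → ℤ) : theta (x + y) z = theta x z + theta y z := by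
  simp only [theta, Pi.add_apply]; ring

theorem theta_smul_left (r : ℤ) (x z : Fin 4 → ℤ) : theta (r • x) z = r * theta x z := by
  simp only [theta, Pi.smul_apply, smul_eq_mul]; ring

theorem theta_swap (x y : Fin 4 → ℤ) : theta y x = -theta x y := by
  simp only [theta]; ring

theorem theta_add_right (x y z : Fin 4 → ℤ) : theta x (y + z) = theta x y + theta x z := by
  simp only [theta, Pi.add_apply]; ring

theorem theta_smul_right (r : ℤ) (x z : Fin 4 → ℤ) : theta x (r • z) = r * theta x z := by
  simp only [theta, Pi.smul_apply, smul_eq_mul]; ring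

/-- A plane: an oriented direct summand of `ℤ⁴` of rank two. -/
structure OrientedPlane where
  carrier : Submodule ℤ (Fin 4 → ℤ)
  summand : ∃ N : Submodule ℤ (Fin 4 → ℤ), IsCompl carrier N
  rank : Module.finrank ℤ carrier = 2
  orientation : Orientation ℤ carrier (Fin 2)

/-- The binary form `q(x, y) = Q(x v + y w)` for `Q = x₁x₂ + x₃x₄`. -/
def pairForm (v w : Fin 4 → ℤ) : IBQF :=
  ⟨ambientForm v, QuadraticMap.polar ambientForm v w, ambientForm w⟩

theorem eval_pairForm (v w : Fin 4 → ℤ) (x y : ℤ) :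
    (pairForm v w).eval x y = ambientForm (x • v + y • w) := by
  simp only [pairForm, IBQF.eval, QuadraticMap.polar, ambientForm, Pi.add_apply, Pi.smul_apply,
    smul_eq_mul]
  ring

namespace OrientedPlane

theorem exists_oriented_basis (L : OrientedPlane) :
    ∃ e : Module.Basis (Fin 2) ℤ L.carrier, e.orientation = L.orientation :=
  ⟨(Module.finBasisOfFinrankEq ℤ L.carrier L.rank).adjustToOrientation L.orientation,
    Module.Basis.orientation_adjustToOrientation _ _⟩

/-- The class `[Q|_L]`: the class of the form `Q(x v₁ + y v₂)` for any oriented basis `(v₁, v₂)`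
of `L`. -/
noncomputable def formClass (L : OrientedPlane) : FormClass :=
  FormClass.mk (pairForm (L.exists_oriented_basis.choose 0) (L.exists_oriented_basis.choose 1))

theorem pairForm_equiv {N : Submodule ℤ (Fin 4 → ℤ)} (e f : Module.Basis (Fin 2) ℤ N)
    (h : e.orientation = f.orientation) : pairForm (e 0) (e 1) ≈ pairForm (f 0) (f 1) := by
  have hpos := (Module.Basis.orientation_eq_iff_det_pos e f).1 h
  have hunit : IsUnit (e.det f) := e.isUnit_det f
  have h1 : e.det f = 1 := by
    rcases Int.isUnit_iff.1 hunit with h | h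
    · exact h
    · rw [h] at hpos; norm_num at hpos
  rw [Module.Basis.det_apply, Matrix.det_fin_two] at h1
  have hf : ∀ j, (f j : Fin 4 → ℤ) =
      e.toMatrix f 0 j • (e 0 : Fin 4 → ℤ) + e.toMatrix f 1 j • (e 1 : Fin 4 → ℤ) := by
    intro j
    have := e.sum_toMatrix_smul_self f j
    rw [Fin.sum_univ_two] at this
    rw [← this]
    rfl
  refine IBQF.equiv_def.2 ⟨_, _, _, _, h1, ?_⟩
  rw [hf 0, hf 1]
  ext <;> simp only [pairForm, IBQF.subst, QuadraticMap.polar, ambientForm, Pi.add_apply,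
    Pi.smul_apply, smul_eq_mul] <;> ring

theorem formClass_eq (L : OrientedPlane) (e : Module.Basis (Fin 2) ℤ L.carrier)
    (h : e.orientation = L.orientation) : L.formClass = FormClass.mk (pairForm (e 0) (e 1)) :=
  FormClass.mk_eq_mk.2 (pairForm_equiv _ _ (L.exists_oriented_basis.choose_spec.trans h.symm))

/-- A plane is symplectic if it has an oriented basis `(v₁, v₂)` with `θ(v₁, v₂) = 1`. -/
def IsSymplectic (L : OrientedPlane) : Prop :=
  ∃ e : Module.Basis (Fin 2) ℤ L.carrier,
    e.orientation = L.orientation ∧ theta (e 0) (e 1) = 1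

/-- The set of all `x` with `θ(x, y) = 0` for all `y ∈ N`. -/
def thetaPerp (N : Submodule ℤ (Fin 4 → ℤ)) : Submodule ℤ (Fin 4 → ℤ) where
  carrier := {x | ∀ y ∈ N, theta x y = 0}
  add_mem' := fun {x x'} hx hx' y hy => by rw [theta_add_left, hx y hy, hx' y hy, add_zero]
  zero_mem' := fun y _ => by simp [theta]
  smul_mem' := fun r x hx y hy => by rw [theta_smul_left, hx y hy, mul_zero]

theorem theta_basis_right {N : Submodule ℤ (Fin 4 → ℤ)} (e : Module.Basis (Fin 2) ℤ N)
    (x : Fin 4 → ℤ) {y : Fin 4 → ℤ} (hy : y ∈ N) :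
    ∃ r s : ℤ, y = r • (e 0 : Fin 4 → ℤ) + s • (e 1 : Fin 4 → ℤ) ∧
      theta x y = r * theta x (e 0) + s * theta x (e 1) := by
  have h := e.sum_repr ⟨y, hy⟩
  rw [Fin.sum_univ_two] at h
  have h' : y = e.repr ⟨y, hy⟩ 0 • (e 0 : Fin 4 → ℤ) + e.repr ⟨y, hy⟩ 1 • (e 1 : Fin 4 → ℤ) :=
    (congrArg Subtype.val h).symm
  refine ⟨_, _, h', ?_⟩
  conv_lhs => rw [h']
  rw [theta_add_right, theta_smul_right, theta_smul_right]

theorem isCompl_thetaPerp {L : OrientedPlane} (hL : L.IsSymplectic) :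
    IsCompl L.carrier (thetaPerp L.carrier) := by
  obtain ⟨e, -, he⟩ := hL
  have hself : ∀ x, theta x x = 0 := fun x => by simp only [theta]; ring
  have he' : theta (e 1) (e 0) = -1 := by rw [theta_swap, he]
  constructor
  · rw [Submodule.disjoint_def]
    intro x hx hx'
    obtain ⟨r, s, hrs, -⟩ := theta_basis_right e 0 hx
    have h0 := hx' _ (e 0).2
    have h1 := hx' _ (e 1).2
    rw [hrs, theta_add_left, theta_smul_left, theta_smul_left] at h0 h1
    rw [hself, he'] at h0
    rw [hself, he] at h1
    have hs : s = 0 := by linarith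
    have hr : r = 0 := by linarith
    rw [hrs, hr, hs]; simp
  · rw [codisjoint_iff, eq_top_iff]
    intro x _
    rw [Submodule.mem_sup]
    refine ⟨theta x (e 1) • (e 0 : Fin 4 → ℤ) + (-theta x (e 0)) • (e 1 : Fin 4 → ℤ), ?_,
      x + (-1 : ℤ) • (theta x (e 1) • (e 0 : Fin 4 → ℤ) + (-theta x (e 0)) • (e 1 : Fin 4 → ℤ)),
      ?_, ?_⟩
    · exact add_mem (Submodule.smul_mem _ _ (e 0).2) (Submodule.smul_mem _ _ (e 1).2)
    · intro y hy
      obtain ⟨r, s, -, h⟩ := theta_basis_right e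
        (x + (-1 : ℤ) • (theta x (e 1) • (e 0 : Fin 4 → ℤ) + (-theta x (e 0)) • (e 1 : Fin 4 → ℤ)))
        hy
      rw [h]
      simp only [theta_add_left, theta_smul_left, hself, he, he']
      ring
    · rw [neg_one_smul]; abel

theorem finrank_thetaPerp {L : OrientedPlane} (hL : L.IsSymplectic) :
    Module.finrank ℤ (thetaPerp L.carrier) = 2 := by
  have h := (Submodule.prodEquivOfIsCompl _ _ (isCompl_thetaPerp hL)).finrank_eq
  rw [Module.finrank_prod, L.rank, Module.finrank_fin_fun] at h
  omega

theorem exists_symplectic_basis_thetaPerp {L : OrientedPlane} (hL : L.IsSymplectic) :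
    ∃ e : Module.Basis (Fin 2) ℤ (thetaPerp L.carrier), theta (e 0) (e 1) = 1 := by
  have hc := isCompl_thetaPerp hL
  set f := Module.finBasisOfFinrankEq ℤ (thetaPerp L.carrier) (finrank_thetaPerp hL) with hf
  have hself : ∀ x, theta x x = 0 := fun x => by simp only [theta]; ring
  have hrep : ∀ φ : (Fin 4 → ℤ) →ₗ[ℤ] ℤ, ∃ z : Fin 4 → ℤ, ∀ x, φ x = theta x z := by
    intro φ
    refine ⟨![-φ (Pi.single 1 1), φ (Pi.single 0 1), -φ (Pi.single 3 1), φ (Pi.single 2 1)],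
      fun x => ?_⟩
    have hx : x = ∑ i, x i • (Pi.single i (1 : ℤ) : Fin 4 → ℤ) := by
      ext j; simp [Finset.sum_apply, Pi.single_apply]
    conv_lhs => rw [hx]
    rw [map_sum]
    simp_rw [LinearMap.map_smul]
    simp [Fin.sum_univ_four, theta]
    ring
  obtain ⟨z, hz⟩ := hrep ((f.coord 0).comp
    ((LinearMap.snd ℤ _ _).comp (Submodule.prodEquivOfIsCompl _ _ hc).symm.toLinearMap))
  have hz0 : theta (f 0) z = 1 := by
    rw [← hz]
    simp
  obtain ⟨l, hl, m, hm, rfl⟩ := Submodule.mem_sup.1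
    (show z ∈ L.carrier ⊔ thetaPerp L.carrier by rw [hc.sup_eq_top]; trivial)
  obtain ⟨r, s, -, h⟩ := theta_basis_right f (f 0) hm
  rw [theta_add_right, (f 0).2 l hl, h, hself] at hz0
  have hu : IsUnit (theta (f 0) (f 1)) := IsUnit.of_mul_eq_one s (by linarith)
  rcases Int.isUnit_iff.1 hu with h1 | h1
  · exact ⟨f, h1⟩
  · refine ⟨f.reindex (Equiv.swap 0 1), ?_⟩
    simp only [Module.Basis.reindex_apply, Equiv.symm_swap, Equiv.swap_apply_left,
      Equiv.swap_apply_right]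
    rw [theta_swap, h1, neg_neg]

/-- The symplectic complement `{x : θ(x, y) = 0 for all y ∈ L}` of a symplectic plane, with the
orientation that makes it symplectic. -/
noncomputable def symplecticComplement (L : OrientedPlane) (hL : L.IsSymplectic) :
    OrientedPlane where
  carrier := thetaPerp L.carrier
  summand := ⟨L.carrier, (isCompl_thetaPerp hL).symm⟩
  rank := finrank_thetaPerp hL
  orientation := (exists_symplectic_basis_thetaPerp hL).choose.orientation

theorem isSymplectic_symplecticComplement (L : OrientedPlane) (hL : L.IsSymplectic) :
    (L.symplecticComplement hL).IsSymplectic :=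
  ⟨(exists_symplectic_basis_thetaPerp hL).choose, rfl,
    (exists_symplectic_basis_thetaPerp hL).choose_spec⟩

end OrientedPlane

/-! Write x = (x', x'') with x' the coordinates along e₁, e₃ and x'' those along e₂, e₄. Then Q(x) =
⟨x', x''⟩ and θ(x, y) = ⟨x', y''⟩ - ⟨y', x''⟩, so a change of basis on x' together with the dual
change on x'' preserves both. This leads to a normal form for a symplectic plane L with integer
parameters n, p, q, s (`exists_normal_form`).

Put f = [n, 1, ps - q(1 + nq)] = [n, 1 + 2nq, ps], of discriminant D, and g = [pn, 1 + 2nq, s]. Then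
[Q|_L] = f⁻¹g, while the reversal of the class of the complement is fg, so the two differ by f². If
f² = 1, then f = f⁻¹ (`equiv_reverse_of_sq`) and the two classes coincide; hence an L as in (i)
produces an f with f² ≠ 1. As g need not be primitive, this comparison takes place outside the class
group and rests on `equiv_of_isComposition`.

Conversely, for f = [n, 1, m] the parameters p = 1, q = 0, s = m give a plane with [Q|_L] = 1 whose
complement has class f⁻². Since 1 is its own reversal, f² ≠ 1 yields both inequalities. -/

/-! ### Composition with a primitive class, and classes of order two. -/

namespace IBQF

/-- Inverse classes are thus obtained by exchanging the outer coefficients, which allows the three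
forms of a concordant triple to be permuted. -/
theorem reverse_equiv_swap (a b c : ℤ) : (⟨a, -b, c⟩ : IBQF) ≈ ⟨c, b, a⟩ :=
  equiv_def.2 ⟨0, -1, 1, 0, by norm_num, by ext <;> simp [subst]⟩

theorem shift_equiv (a b c k : ℤ) : (⟨a, b, c⟩ : IBQF) ≈ ⟨a, b + 2 * a * k, a * k ^ 2 + b * k + c⟩ :=
  equiv_def.2 ⟨1, k, 0, 1, by norm_num, by ext <;> simp [subst]; ring⟩

/-- Composition with a primitive class is well defined, even on classes that are not primitive. -/
theorem equiv_of_isComposition {q q' r r' : IBQF} (hq : q.content = 1) {s t : FormClass}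
    (hs : s = FormClass.mk q) (ht : t = FormClass.mk q')
    (h : FormClass.IsComposition s t (FormClass.mk r))
    (h' : FormClass.IsComposition s t (FormClass.mk r')) : r ≈ r' := by
  -- Both compositions are moved to cubes over the same pair `q`, `q'`. `IsCube.unique` needs a
  -- Bézout relation only for the coefficients of the first form.
  have cube : ∀ {r : IBQF}, FormClass.IsComposition s t (FormClass.mk r) →
      ∃ (X Y : Fin 4 → ℤ) (r₁ : IBQF), IsCube X Y q q' r₁ ∧ r ≈ r₁ := by
    rintro r ⟨a₁, a₂, b, c, h₁, h₂, h₃⟩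
    obtain ⟨X, Y, hX⟩ := (isCube_concordant a₁ a₂ b c).exists_left
      (FormClass.mk_eq_mk.1 (h₁.symm.trans hs))
    obtain ⟨X', Y', hX'⟩ := hX.swap.exists_left (FormClass.mk_eq_mk.1 (h₂.symm.trans ht))
    exact ⟨_, _, _, hX'.swap, FormClass.mk_eq_mk.1 h₃⟩
  obtain ⟨X, Y, r₁, hX, e⟩ := cube h
  obtain ⟨X', Y', r₁', hX', e'⟩ := cube h'
  exact Setoid.trans e (Setoid.trans (hX.unique hq hX') (Setoid.symm e'))

theorem content_eq_one_of_b {a c : ℤ} : (⟨a, 1, c⟩ : IBQF).content = 1 := by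
  simp [content]

/-- A class whose square is the class of `x² + xy + d y²` is invariant under reversal. -/
theorem equiv_reverse_of_sq {f : IBQF} (hf : f.content = 1) {d : ℤ} (hd : f.disc = 1 - 4 * d)
    (h : FormClass.IsComposition (FormClass.mk f) (FormClass.mk f) (FormClass.mk ⟨1, 1, d⟩)) :
    f ≈ f.reverse := by
  obtain ⟨a₁, a₂, b, c, h₁, h₂, h₃⟩ := h
  have hone : (⟨1, 1, d⟩ : IBQF) ≈ ⟨1, -1, d⟩ := by
    have := shift_equiv 1 1 d (-1)
    norm_num at this
    exact this
  rw [FormClass.mk_eq_mk] at h₁ h₂ h₃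
  -- Both `f` and `f.reverse` are compositions of `f` with the neutral class.
  refine equiv_of_isComposition hf (q' := ⟨1, 1, d⟩) rfl rfl ?_ ?_
  · -- `f · 1 = f`
    obtain ⟨a, b, c⟩ := f
    have hb : ∃ k, b = 2 * k + 1 := by
      have : Odd (b ^ 2) := ⟨2 * (a * c - d), by simp only [disc] at hd; linarith⟩
      exact (Int.odd_pow' two_ne_zero).1 this
    obtain ⟨k, rfl⟩ := hb
    refine ⟨a, 1, 2 * k + 1, c, by simp, ?_, by simp⟩
    rw [FormClass.mk_eq_mk]
    have := shift_equiv 1 1 d k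
    convert this using 2
    · ring
    · simp only [disc] at hd; linarith
  -- The triple witnessing f · f = 1, with its roles permuted, reads f · 1⁻¹ = f⁻¹; and 1⁻¹ = 1 by
  -- `hone`.
  · refine ⟨a₂, c, b, a₁, ?_, ?_, ?_⟩
    · rw [FormClass.mk_eq_mk, mul_comm c]; exact h₂
    · rw [FormClass.mk_eq_mk, mul_comm a₂]
      exact Setoid.trans hone (Setoid.trans (reverse_equiv h₃) (reverse_equiv_swap _ _ _))
    · rw [FormClass.mk_eq_mk, mul_comm a₂]
      refine Setoid.trans (reverse_equiv h₁) ?_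
      rw [mul_comm c]
      exact reverse_equiv_swap _ _ _

end IBQF

/-! ### Primitive combinations of two integral rows. -/

/-- An integral pair of rows without common prime divisor has a primitive row combination. -/
theorem exists_isCoprime_combination {a b c d : ℤ}
    (h : ∀ p : ℕ, p.Prime → (p : ℤ) ∣ a → (p : ℤ) ∣ b → (p : ℤ) ∣ c → (p : ℤ) ∣ d → False) :
    ∃ x y : ℤ, IsCoprime (x * a + y * c) (x * b + y * d) := by
  by_cases hn : a * d - b * c = 0
  · by_cases hac : Int.gcd a c = 0
    · obtain ⟨rfl, rfl⟩ := Int.gcd_eq_zero_iff.1 hac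
      have hbd : IsCoprime b d := by
        rw [Int.isCoprime_iff_gcd_eq_one]
        by_contra hg
        obtain ⟨p, hp, hpd⟩ := Nat.exists_prime_and_dvd hg
        rw [Int.dvd_gcd_iff] at hpd
        exact h p hp (dvd_zero _) hpd.1 (dvd_zero _) hpd.2
      obtain ⟨x, y, hxy⟩ := hbd
      exact ⟨x, y, by rw [hxy]; exact isCoprime_one_right⟩
    -- In rank one both columns are multiples of the primitive column (α, β). With xα + yβ = 1 the
    -- combination consists of the two multipliers, so a common prime of these would divide all four
    -- entries.
    · obtain ⟨α, β, hαβ, ha, hc⟩ := Int.exists_gcd_one (Nat.pos_of_ne_zero hac)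
      set g : ℤ := (Int.gcd a c : ℤ) with hg
      have hg0 : g ≠ 0 := Int.natCast_ne_zero.2 hac
      obtain ⟨x, y, hxy⟩ := Int.isCoprime_iff_gcd_eq_one.2 hαβ
      have hbd : α * d = β * b := by
        apply mul_right_cancel₀ hg0
        linear_combination hn - d * ha + b * hc
      have hb : b = α * (x * b + y * d) := by linear_combination (-b) * hxy - y * hbd
      have hd : d = β * (x * b + y * d) := by linear_combination (-d) * hxy + x * hbd
      have hxa : x * a + y * c = g := by linear_combination x * ha + y * hc + g * hxy
      refine ⟨x, y, ?_⟩
      rw [Int.isCoprime_iff_gcd_eq_one]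
      by_contra hk
      obtain ⟨p, hp, hpd⟩ := Nat.exists_prime_and_dvd hk
      rw [Int.dvd_gcd_iff, hxa] at hpd
      refine h p hp ?_ ?_ ?_ ?_
      · rw [ha]; exact hpd.1.mul_left _
      · rw [hb]; exact hpd.2.mul_left _
      · rw [hc]; exact hpd.1.mul_left _
      · rw [hd]; exact hpd.2.mul_left _
  · classical
    -- A prime dividing x(a, b) + (c, d) divides x · det. Taking x to be the product of the primes
    -- of the determinant that do not divide (c, d) excludes those primes; a prime dividing (c, d)
    -- does not divide x, so it would have to divide (a, b) as well.
    set S := (a * d - b * c).natAbs.primeFactors.filter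
      fun p : ℕ => ¬ ((p : ℤ) ∣ c ∧ (p : ℤ) ∣ d) with hS
    set x : ℤ := ((∏ r ∈ S, r : ℕ) : ℤ) with hx
    refine ⟨x, 1, ?_⟩
    rw [Int.isCoprime_iff_gcd_eq_one]
    by_contra hk
    obtain ⟨p, hp, hpd⟩ := Nat.exists_prime_and_dvd hk
    rw [Int.dvd_gcd_iff, one_mul, one_mul] at hpd
    obtain ⟨h1, h2⟩ := hpd
    have hpi := Nat.prime_iff_prime_int.1 hp
    by_cases hcd : (p : ℤ) ∣ c ∧ (p : ℤ) ∣ d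
    · have hpx : ¬ (p : ℤ) ∣ x := by
        rw [hx, Int.natCast_dvd_natCast, hp.prime.dvd_finsetProd_iff]
        rintro ⟨r, hr, hpr⟩
        rw [hS, Finset.mem_filter] at hr
        rw [← (Nat.prime_dvd_prime_iff_eq hp (Nat.prime_of_mem_primeFactors hr.1)).1 hpr] at hr
        exact hr.2 hcd
      have ha := (hpi.dvd_or_dvd ((dvd_add_left hcd.1).1 h1)).resolve_left hpx
      have hb := (hpi.dvd_or_dvd ((dvd_add_left hcd.2).1 h2)).resolve_left hpx
      exact h p hp ha hb hcd.1 hcd.2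
    · have hpn : (p : ℤ) ∣ a * d - b * c := by
        by_cases hpx : (p : ℤ) ∣ x
        · exact absurd ⟨(dvd_add_right (hpx.mul_right _)).1 h1,
            (dvd_add_right (hpx.mul_right _)).1 h2⟩ hcd
        · refine (hpi.dvd_or_dvd (a := x) ?_).resolve_left hpx
          have : x * (a * d - b * c) = (x * a + c) * d - (x * b + d) * c := by ring
          rw [this]
          exact dvd_sub (h1.mul_right _) (h2.mul_right _)
      have hpS : p ∈ S := by
        rw [hS, Finset.mem_filter]
        exact ⟨Nat.mem_primeFactors.2 ⟨hp, Int.natCast_dvd.1 hpn, Int.natAbs_ne_zero.2 hn⟩, hcd⟩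
      have hpx : (p : ℤ) ∣ x := Int.natCast_dvd_natCast.2 (Finset.dvd_prod_of_mem _ hpS)
      exact hcd ⟨(dvd_add_right (hpx.mul_right _)).1 h1, (dvd_add_right (hpx.mul_right _)).1 h2⟩

/-! ### Symplectic pairs and the normal form of a plane with its complement. -/

namespace OrientedPlane

theorem theta_self (x : Fin 4 → ℤ) : theta x x = 0 := by simp only [theta]; ring

theorem eq_combination {N : Submodule ℤ (Fin 4 → ℤ)} (e : Module.Basis (Fin 2) ℤ N)
    (he : theta (e 0) (e 1) = 1) {v : Fin 4 → ℤ} (hv : v ∈ N) :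
    v = theta v (e 1) • (e 0 : Fin 4 → ℤ) + (-theta v (e 0)) • (e 1 : Fin 4 → ℤ) := by
  obtain ⟨r, s, h, -⟩ := theta_basis_right e 0 hv
  have h0 : theta v (e 0) = -s := by
    rw [h, theta_add_left, theta_smul_left, theta_smul_left, theta_self, theta_swap (e 0), he]; ring
  have h1 : theta v (e 1) = r := by
    rw [h, theta_add_left, theta_smul_left, theta_smul_left, theta_self, he]; ring
  rw [h0, h1, neg_neg]
  exact h

/-- The class `[Q|_L]` of a symplectic plane can be computed in any symplectic pair of vectors. -/
theorem IsSymplectic.formClass_eq_mk {L : OrientedPlane} (hL : L.IsSymplectic)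
    {v w : Fin 4 → ℤ} (hv : v ∈ L.carrier) (hw : w ∈ L.carrier) (h : theta v w = 1) :
    L.formClass = FormClass.mk (pairForm v w) := by
  obtain ⟨e, heo, he⟩ := hL
  rw [L.formClass_eq e heo, FormClass.mk_eq_mk]
  have hv' := eq_combination e he hv
  have hw' := eq_combination e he hw
  generalize theta v (e 1) = p at hv'
  generalize -theta v (e 0) = s at hv'
  generalize theta w (e 1) = r at hw'
  generalize -theta w (e 0) = t at hw'
  refine IBQF.equiv_def.2 ⟨p, r, s, t, ?_, ?_⟩
  · rw [hv', hw'] at h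
    simp only [theta_add_left, theta_add_right, theta_smul_left, theta_smul_right, theta_self,
      theta_swap (e 0) (e 1), he] at h
    linarith
  · rw [hv', hw']
    ext <;> simp only [pairForm, IBQF.subst, QuadraticMap.polar, ambientForm, Pi.add_apply,
      Pi.smul_apply, smul_eq_mul] <;> ring

theorem IsSymplectic.mem_thetaPerp {L : OrientedPlane} (hL : L.IsSymplectic)
    {v w x : Fin 4 → ℤ} (hv : v ∈ L.carrier) (hw : w ∈ L.carrier) (h : theta v w = 1)
    (hxv : theta x v = 0) (hxw : theta x w = 0) : x ∈ thetaPerp L.carrier := by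
  obtain ⟨e, -, he⟩ := hL
  have hv' := eq_combination e he hv
  have hw' := eq_combination e he hw
  generalize theta v (e 1) = p at hv'
  generalize -theta v (e 0) = s at hv'
  generalize theta w (e 1) = r at hw'
  generalize -theta w (e 0) = t at hw'
  have hdet : p * t - s * r = 1 := by
    rw [hv', hw'] at h
    simp only [theta_add_left, theta_add_right, theta_smul_left, theta_smul_right, theta_self,
      theta_swap (e 0) (e 1), he] at h
    linarith
  rw [hv', theta_add_right, theta_smul_right, theta_smul_right] at hxv
  rw [hw', theta_add_right, theta_smul_right, theta_smul_right] at hxw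
  have h0 : theta x (e 0) = 0 := by
    linear_combination (-theta x (e 0)) * hdet + t * hxv - s * hxw
  have h1 : theta x (e 1) = 0 := by
    linear_combination (-theta x (e 1)) * hdet - r * hxv + p * hxw
  intro y hy
  obtain ⟨i, j, -, hij⟩ := theta_basis_right e x hy
  rw [hij, h0, h1]; ring

/-- A symplectic pair of vectors spans a symplectic plane. -/
theorem exists_of_theta_eq_one {v w : Fin 4 → ℤ} (h : theta v w = 1) :
    ∃ L : OrientedPlane, L.IsSymplectic ∧ v ∈ L.carrier ∧ w ∈ L.carrier := by
  have hwv : theta w v = -1 := by rw [theta_swap, h]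
  have hli : LinearIndependent ℤ ![v, w] := by
    rw [LinearIndependent.pair_iff]
    intro s t hst
    have h1 : theta (s • v + t • w) w = 0 := by rw [hst]; simp [theta]
    have h2 : theta (s • v + t • w) v = 0 := by rw [hst]; simp [theta]
    simp only [theta_add_left, theta_smul_left, theta_self, h, hwv] at h1 h2
    constructor <;> linarith
  let e := Module.Basis.span hli
  have e0 : (e 0 : Fin 4 → ℤ) = v := by simp [e, Module.Basis.span_apply]
  have e1 : (e 1 : Fin 4 → ℤ) = w := by simp [e, Module.Basis.span_apply]
  have hv : v ∈ Submodule.span ℤ (Set.range ![v, w]) := Submodule.subset_span ⟨0, rfl⟩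
  have hw : w ∈ Submodule.span ℤ (Set.range ![v, w]) := Submodule.subset_span ⟨1, rfl⟩
  have he : theta (e 0) (e 1) = 1 := by rw [e0, e1, h]
  refine ⟨⟨Submodule.span ℤ (Set.range ![v, w]), ⟨thetaPerp (Submodule.span ℤ (Set.range ![v, w])),
    ?_, ?_⟩, ?_, e.orientation⟩, ⟨e, rfl, he⟩, hv, hw⟩
  · rw [Submodule.disjoint_def]
    intro x hx hx'
    rw [eq_combination e he hx, hx' _ (e 0).2, hx' _ (e 1).2]
    simp
  · rw [codisjoint_iff, eq_top_iff]
    intro x _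
    rw [Submodule.mem_sup]
    refine ⟨theta x w • v + (-theta x v) • w,
      add_mem (Submodule.smul_mem _ _ hv) (Submodule.smul_mem _ _ hw),
      x + (-1 : ℤ) • (theta x w • v + (-theta x v) • w), fun y hy => ?_, ?_⟩
    · rw [eq_combination e he hy, e0, e1]
      simp only [theta_add_left, theta_smul_left, theta_add_right, theta_smul_right, theta_self,
        h, hwv]
      ring
    · rw [neg_one_smul]; abel
  · rw [Module.finrank_eq_card_basis e, Fintype.card_fin]

/-- A symplectic pair can be replaced by one for which the components along the Lagrangian
`⟨e₁, e₃⟩` are a primitive vector `u` and a multiple of a vector completing `u` to a basis. -/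
theorem exists_reduced_pair {N : Submodule ℤ (Fin 4 → ℤ)} {v w : Fin 4 → ℤ} (hv : v ∈ N)
    (hw : w ∈ N) (h : theta v w = 1) :
    ∃ v' ∈ N, ∃ w' ∈ N, theta v' w' = 1 ∧ ∃ n α β : ℤ,
      α * v' 0 + β * v' 2 = 1 ∧ w' 0 = n * -β ∧ w' 2 = n * α := by
  obtain ⟨x, y, hxy⟩ : ∃ x y : ℤ, IsCoprime (x * v 0 + y * w 0) (x * v 2 + y * w 2) := by
    -- A prime dividing all components along e₁, e₃ would divide θ(v, w) = 1.
    refine exists_isCoprime_combination fun p hp h1 h2 h3 h4 => ?_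
    refine (Nat.prime_iff_prime_int.1 hp).not_dvd_one ?_
    rw [← h]
    exact dvd_add (dvd_sub (h1.mul_right _) (h3.mul_left _)) (dvd_sub (h2.mul_right _)
      (h4.mul_left _))
  obtain ⟨α, β, hαβ⟩ := hxy
  set x' := α * v 0 + β * v 2 with hx'
  set y' := α * w 0 + β * w 2 with hy'
  -- The Bézout relation for the combined vector is also one for (x, y), so it supplies the second
  -- row of a unimodular change of basis.
  have hdet : x * x' + y * y' = 1 := by rw [hx', hy']; linear_combination hαβ
  have hwv : theta w v = -1 := by rw [theta_swap, h]
  set v₁ := x • v + y • w with hv₁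
  set w₁ := (-y') • v + x' • w with hw₁
  have hv₁N : v₁ ∈ N := add_mem (Submodule.smul_mem _ _ hv) (Submodule.smul_mem _ _ hw)
  have hw₁N : w₁ ∈ N := add_mem (Submodule.smul_mem _ _ hv) (Submodule.smul_mem _ _ hw)
  have hu : α * v₁ 0 + β * v₁ 2 = 1 := by
    simp only [hv₁, Pi.add_apply, Pi.smul_apply, smul_eq_mul]
    linear_combination hαβ
  have hθ : theta v₁ w₁ = 1 := by
    simp only [hv₁, hw₁, theta_add_left, theta_smul_left, theta_add_right, theta_smul_right,
      theta_self, h, hwv]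
    linear_combination hdet
  clear_value v₁ w₁
  -- The multiple of `v₁` puts the second vector into the kernel of the functional (α, β) on the e₁,
  -- e₃ components; this kernel is spanned by (-β, α).
  refine ⟨v₁, hv₁N, w₁ + (-(α * w₁ 0 + β * w₁ 2)) • v₁,
    add_mem hw₁N (Submodule.smul_mem _ _ hv₁N), ?_, v₁ 0 * w₁ 2 - v₁ 2 * w₁ 0, α, β, hu, ?_, ?_⟩
  · rw [theta_add_right, theta_smul_right, theta_self, hθ]; ring
  · simp only [Pi.add_apply, Pi.smul_apply, smul_eq_mul]
    linear_combination (-w₁ 0) * hu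
  · simp only [Pi.add_apply, Pi.smul_apply, smul_eq_mul]
    linear_combination (-w₁ 2) * hu

/-- Normal form of the pair of a symplectic plane and its symplectic complement. -/
theorem IsSymplectic.exists_normal_form {L : OrientedPlane} (hL : L.IsSymplectic) :
    ∃ n p q s : ℤ, L.formClass = FormClass.mk ⟨p, 1 + 2 * n * q, n * s⟩ ∧
      (L.symplecticComplement hL).formClass.reverse =
        FormClass.mk ⟨p * n ^ 2, 1 + 2 * n * q - 2 * p * n * s, p * s ^ 2 - 2 * q * s⟩ := by
  obtain ⟨e, -, he⟩ := id hL
  obtain ⟨v, hv, w, hw, h, n, α, β, hu, hw0, hw2⟩ := exists_reduced_pair (e 0).2 (e 1).2 he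
  -- Use the basis u = (v 0, v 2), u₂ = (-β, α) and its dual basis (α, β), (-v 2, v 0). Then v = (u;
  -- p, q) and w = (n u₂; r, s), and θ(v, w) = r - nq forces r = 1 + nq.
  set p := v 1 * v 0 + v 3 * v 2 with hp
  set q := -β * v 1 + α * v 3 with hq
  set s := -β * w 1 + α * w 3 with hs
  have hr : w 1 * v 0 + w 3 * v 2 = 1 + n * q := by
    simp only [theta] at h
    rw [hw0, hw2] at h
    rw [hq]; linear_combination h
  have hv1 : v 1 = p * α - q * v 2 := by rw [hp, hq]; linear_combination (-v 1) * hu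
  have hv3 : v 3 = p * β + q * v 0 := by rw [hp, hq]; linear_combination (-v 3) * hu
  have hw1 : w 1 = (1 + n * q) * α - s * v 2 := by
    rw [← hr, hs]; linear_combination (-w 1) * hu
  have hw3 : w 3 = (1 + n * q) * β + s * v 0 := by
    rw [← hr, hs]; linear_combination (-w 3) * hu
  clear_value p q s
  clear hr hp hq hs
  refine ⟨n, p, q, s, ?_, ?_⟩
  · rw [hL.formClass_eq_mk hv hw h]
    congr 1
    ext <;> simp only [pairForm, QuadraticMap.polar, ambientForm, Pi.add_apply, hw0, hw2, hv1, hv3,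
      hw1, hw3]
    · linear_combination p * hu
    · linear_combination (1 + 2 * n * q) * hu
    · linear_combination n * s * hu
  -- In the same bases x = (-s u + u₂; q - ps, -qs) and y = (n u; pn, 1 + nq), a symplectic pair
  -- orthogonal to v and w.
  · set x : Fin 4 → ℤ := ![-s * v 0 - β, (q - p * s) * α + q * s * v 2, -s * v 2 + α,
      (q - p * s) * β - q * s * v 0] with hx
    set y : Fin 4 → ℤ := ![n * v 0, p * n * α - (1 + n * q) * v 2, n * v 2,
      p * n * β + (1 + n * q) * v 0] with hy
    have hxy : theta x y = 1 := by
      simp [theta, hx, hy]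
      linear_combination hu
    have hxN : x ∈ thetaPerp L.carrier := by
      refine hL.mem_thetaPerp hv hw h ?_ ?_ <;> simp [theta, hx, hw0, hw2, hv1, hv3, hw1, hw3]
      · ring
      · ring
    have hyN : y ∈ thetaPerp L.carrier := by
      refine hL.mem_thetaPerp hv hw h ?_ ?_ <;> simp [theta, hy, hw0, hw2, hv1, hv3, hw1, hw3]
      · ring
      · ring
    rw [(L.isSymplectic_symplecticComplement hL).formClass_eq_mk hxN hyN hxy]
    change FormClass.mk (pairForm x y).reverse = _
    rw [FormClass.mk_eq_mk]
    refine Setoid.trans ?_ (IBQF.reverse_equiv_swap _ _ _)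
    convert Setoid.refl _ using 1
    ext <;> simp [IBQF.reverse, pairForm, QuadraticMap.polar, ambientForm, hx, hy]
    · linear_combination -(p * s ^ 2 - 2 * q * s) * hu
    · linear_combination -(2 * p * n * s - 2 * n * q - 1) * hu
    · linear_combination -(p * n ^ 2) * hu

end OrientedPlane

/-! ### The equivalence. -/

theorem corollary1p6 (D : ℤ) (hD : D ≡ 1 [ZMOD 4]) :
    (∃ (L : OrientedPlane) (hL : L.IsSymplectic),
      L.formClass.disc = D ∧
      L.formClass ≠ (L.symplecticComplement hL).formClass ∧
      L.formClass ≠ (L.symplecticComplement hL).formClass.reverse) ↔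
    ∃ (a c : ℤ) (h : 1 - 4 * a * c = D),
      OrientedClassGroup.special a c h * OrientedClassGroup.special a c h ≠
        OrientedClassGroup.principal hD := by
  constructor
  · rintro ⟨L, hL, hdisc, -, hne⟩
    obtain ⟨n, p, q, s, h₁, h₂⟩ := hL.exists_normal_form
    rw [h₁] at hdisc
    change (1 + 2 * n * q) ^ 2 - 4 * p * (n * s) = D at hdisc
    have hDnm : 1 - 4 * n * (p * s - q * (1 + n * q)) = D := by rw [← hdisc]; ring
    -- The last coefficient is the one for which the translation by q turns [n, 1, ·] into [n, 1 +
    -- 2nq, ps].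
    refine ⟨n, p * s - q * (1 + n * q), hDnm, fun hsq => hne ?_⟩
    rw [OrientedClassGroup.mul_eq_iff] at hsq
    set f : IBQF := ⟨n, 1, p * s - q * (1 + n * q)⟩ with hf
    have hff := IBQF.equiv_reverse_of_sq (f := f) IBQF.content_eq_one_of_b
      (d := (1 - D) / 4) (by
        have := Int.mul_ediv_cancel' hD.dvd
        change 1 ^ 2 - 4 * n * _ = _
        linarith) hsq
    have hfb : f ≈ ⟨n, 1 + 2 * n * q, p * s⟩ := by
      convert IBQF.shift_equiv n 1 _ q using 2
      ring
    rw [h₁, h₂, FormClass.mk_eq_mk]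
    refine IBQF.equiv_of_isComposition (q := f) IBQF.content_eq_one_of_b
      (q' := ⟨p * n, 1 + 2 * n * q, s⟩) rfl rfl ?_ ?_
    -- f⁻¹g = [Q|_L], where f = f⁻¹ lets f stand for its inverse.
    · refine ⟨n, s, -(1 + 2 * n * q), p, ?_, ?_, ?_⟩ <;> rw [FormClass.mk_eq_mk]
      · rw [mul_comm s]
        exact Setoid.trans hff (IBQF.reverse_equiv hfb)
      · rw [mul_comm n p]
        exact Setoid.symm (IBQF.reverse_equiv_swap _ _ _)
      · exact Setoid.symm (IBQF.reverse_equiv_swap _ _ _)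
    -- fg is the reversed class of the complement: translating f by -ps and g by -s makes them
    -- concordant.
    · refine ⟨n, p * n, 1 + 2 * n * q - 2 * p * n * s, p * s ^ 2 - 2 * q * s, ?_, ?_, ?_⟩ <;>
        rw [FormClass.mk_eq_mk]
      · refine Setoid.trans hfb ?_
        convert IBQF.shift_equiv n (1 + 2 * n * q) (p * s) (-(p * s)) using 2 <;> ring
      · convert IBQF.shift_equiv (p * n) (1 + 2 * n * q) s (-s) using 2 <;> ring
      · convert Setoid.refl _ using 2
        ring
  · rintro ⟨n, m, h, hne⟩
    -- The normal form with p = 1, q = 0, s = m, α = 1, β = 0; x and y are the corresponding basis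
    -- of the complement.
    set v : Fin 4 → ℤ := ![1, 1, 0, 0] with hv
    set w : Fin 4 → ℤ := ![0, 1, n, m] with hw
    set x : Fin 4 → ℤ := ![-m, -m, 1, 0] with hx
    set y : Fin 4 → ℤ := ![n, n, 0, 1] with hy
    have hvw : theta v w = 1 := by simp [theta, hv, hw]
    have hxy : theta x y = 1 := by simp [theta, hx, hy]
    obtain ⟨L, hL, hvL, hwL⟩ := OrientedPlane.exists_of_theta_eq_one hvw
    have hxL : x ∈ OrientedPlane.thetaPerp L.carrier := by
      refine hL.mem_thetaPerp hvL hwL hvw ?_ ?_ <;> simp [theta, hx, hv, hw]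
    have hyL : y ∈ OrientedPlane.thetaPerp L.carrier := by
      refine hL.mem_thetaPerp hvL hwL hvw ?_ ?_ <;> simp [theta, hy, hv, hw]
    have h₁ : L.formClass = FormClass.mk ⟨1, 1, n * m⟩ := by
      rw [hL.formClass_eq_mk hvL hwL hvw]
      congr 1
      ext <;> simp [pairForm, QuadraticMap.polar, ambientForm, hv, hw]
      ring
    have h₂ : (L.symplecticComplement hL).formClass =
        FormClass.mk ⟨m ^ 2, 1 - 2 * n * m, n ^ 2⟩ := by
      rw [(L.isSymplectic_symplecticComplement hL).formClass_eq_mk hxL hyL hxy]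
      congr 1
      ext <;> simp [pairForm, QuadraticMap.polar, ambientForm, hx, hy] <;> ring
    -- The form on the left represents f²: after translation by -m, f is concordant with itself.
    have hsq : ¬ (⟨n ^ 2, 1 - 2 * n * m, m ^ 2⟩ : IBQF) ≈ ⟨1, 1, n * m⟩ := by
      refine fun he => hne ?_
      rw [OrientedClassGroup.mul_eq_iff]
      have hf : (⟨n, 1, m⟩ : IBQF) ≈ ⟨n, 1 - 2 * n * m, n * m ^ 2⟩ := by
        convert IBQF.shift_equiv n 1 m (-m) using 2 <;> ring
      refine ⟨n, n, 1 - 2 * n * m, m ^ 2, FormClass.mk_eq_mk.2 hf, FormClass.mk_eq_mk.2 hf, ?_⟩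
      have hc : (1 - D) / 4 = n * m := Int.ediv_eq_of_eq_mul_right (by norm_num) (by linarith)
      change FormClass.mk ⟨1, 1, (1 - D) / 4⟩ = _
      rw [hc, ← sq]
      exact (FormClass.mk_eq_mk.2 he).symm
    have hrev : (⟨m ^ 2, -(1 - 2 * n * m), n ^ 2⟩ : IBQF) ≈ ⟨n ^ 2, 1 - 2 * n * m, m ^ 2⟩ :=
      IBQF.reverse_equiv_swap _ _ _
    have hone : (⟨1, -1, n * m⟩ : IBQF) ≈ ⟨1, 1, n * m⟩ := by
      convert IBQF.shift_equiv 1 (-1) (n * m) 1 using 2 <;> ring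
    refine ⟨L, hL, ?_, fun he => hsq ?_, fun he => hsq ?_⟩
    · rw [h₁]
      change 1 ^ 2 - 4 * 1 * (n * m) = D
      linarith
    · rw [h₁, h₂, FormClass.mk_eq_mk] at he
      exact Setoid.trans (Setoid.symm hrev) (Setoid.trans (Setoid.symm (IBQF.reverse_equiv he)) hone)
    · rw [h₁, h₂] at he
      exact Setoid.symm (Setoid.trans (FormClass.mk_eq_mk.1 he) hrev)
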